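/- **Signature, models.** Let $\mathscr S=\langle \mathcal U,\mathcal V,\mathcal O,\mathcal R\rangle$ be a finite signature with observables: disjoint finite sets $\mathcal U$ (exogenous variables) and $\mathcal V$ (endogenous variables), $\mathcal W=\mathcal U\cup\mathcal V\neq\emptyset$, a finite non-empty range $\mathcal R(X)$ for every $X\in\mathcal W$, and a set $\mathcal O\subseteq\mathcal W$ of observables. A set of structural functions $\mathcal F$ consists of a map $F_V:\prod_{X\ne V}\mathcal R(X)\to\mathcal R(V)$ for each $V\in\mathcal V$. A variable $X\neq V$ directly affects $V$ if changing only the value of $X$ can change the value of $F_V$; $\mathcal F$ is recursive if the transitive closure of this relation is a strict partial order. A valuation $\mathcal A\in\prod_X\mathcal R(X)$ complies with $\mathcal F$ if $\mathcal A(V)=F_V(\mathcal A|_{\mathcal W\setminus\{V\}})$ for all $V\in\mathcal V$. An epistemic causal model with observables is a pair $\langle\mathcal F,\mathcal T\rangle$ with $\mathcal F$ recursive and $\mathcal T$ a non-empty set of valuations complying with $\mathcal F$ that all agree on $\mathcal O$. An assignment $\vec X=\vec x$ gives values to a (possibly empty) set of variables. $\mathcal F_{\vec X=\vec x}$ arises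 from $\mathcal F$ by making $F_V$ constant, with the assigned value, for each $V\in\mathcal V\cap\vec X$; $\mathcal A^{\mathcal F}_{\vec X=\vec x}$ is the unique valuation that has the assigned values on $\mathcal U\cap\vec X$, agrees with $\mathcal A$ on $\mathcal U\setminus\vec X$, and complies with $\mathcal F_{\vec X=\vec x}$. For $\mathcal A\in\mathcal T$ put $\mathcal T^{\mathcal F,\mathcal A}_{\vec X=\vec x}=\{\mathcal B^{\mathcal F}_{\vec X=\vec x}:\mathcal B\in\mathcal T,\ \mathcal B^{\mathcal F}_{\vec X=\vec x}(O)=\mathcal A^{\mathcal F}_{\vec X=\vec x}(O)\text{ for all }O\in\mathcal O\}$. **Language and semantics.** $\mathcal L_{PAKC}$ is given by $\chi::=Y{=}y\mid\neg\chi\mid\chi\wedge\chi\mid K\chi\mid[\chi!]\chi\mid[\vec X{=}\vec x]\chi$; $\mathcal L_C$ is its fragment without $K$ and without announcements $[\chi!]$. With the usual Boolean clauses: $(\langle\mathcal F,\mathcal T\rangle,\mathcal A)\models Y{=}y$ iff $\mathcal A(Y)=y$; $\models K\chi$ iff $(\langle\mathcal F,\mathcal T\rangle,\mathcal B)\models\chi$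 for all $\mathcal B\in\mathcal T$; $\models[\alpha!]\chi$ iff $(\langle\mathcal F,\mathcal T\rangle,\mathcal A)\models\alpha$ implies $(\langle\mathcal F,\mathcal T^\alpha\rangle,\mathcal A)\models\chi$, where $\mathcal T^\alpha=\{\mathcal B\in\mathcal T:(\langle\mathcal F,\mathcal T\rangle,\mathcal B)\models\alpha\}$; $\models[\vec X{=}\vec x]\chi$ iff $(\langle\mathcal F_{\vec X=\vec x},\mathcal T^{\mathcal F,\mathcal A}_{\vec X=\vec x}\rangle,\mathcal A^{\mathcal F}_{\vec X=\vec x})\models\chi$. Write $\Gamma\models^O\varphi$ if for every epistemic causal model with observables and every $\mathcal A\in\mathcal T$ at which all formulas of $\Gamma$ hold, $\varphi$ holds. **Axiom system $\mathsf L^O_{PAKC}$.** Formulas range over $\mathcal L_{PAKC}$ except in $A_{[][]}$. Abbreviate $[\mathbf x]$ for $[\vec X{=}\vec x]$ (the empty assignment included), and let $X\rightsquigarrow V$ be the disjunction of all $[\vec z,X{=}x_1]V{=}v_1\wedge[\vec z,X{=}x_2]V{=}v_2$ with $x_1\ne x_2$, $v_1\neq v_2$ and $\vec z\in\mathcal R(\mathcal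 W\setminus\{X,V\})$, for $X\neq V$ ($\bot$ for $X=V$). * Propositional tautologies; modus ponens; necessitation: from $\chi$ infer $K\chi$, $[\mathbf x]\chi$, $[\alpha!]\chi$. * $A_1$: $[\mathbf x]Y{=}y\to\neg[\mathbf x]Y{=}y'$ ($y\ne y'$). $A_2$: $\bigvee_{y}[\mathbf x]Y{=}y$. $A_3$: $([\mathbf x]Y{=}y\wedge[\mathbf x]Z{=}z)\to[\mathbf x,Y{=}y]Z{=}z$. $A_4$: $[\mathbf x,Y{=}y]Y{=}y$. $A_5$: $([\mathbf x,Y{=}y]Z{=}z\wedge[\mathbf x,Z{=}z]Y{=}y)\to[\mathbf x]Z{=}z$ ($Y\neq Z$). In $A_3$–$A_5$ the added variables are not in $\vec X$. $A_6$: $(X_0\rightsquigarrow X_1\wedge\dots\wedge X_{k-1}\rightsquigarrow X_k)\to\neg(X_k\rightsquigarrow X_0)$. $A_7$: $[\,]U{=}u\leftrightarrow[\mathbf x]U{=}u$ ($U\in\mathcal U\setminus\vec X$). * $A_{[]}$: $Y{=}y\leftrightarrow[\,]Y{=}y$. $A_\neg$: $[\mathbf x]\neg\chi\leftrightarrow\neg[\mathbf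 x]\chi$. $A_\wedge$: $[\mathbf x](\chi_1\wedge\chi_2)\leftrightarrow([\mathbf x]\chi_1\wedge[\mathbf x]\chi_2)$. $A_{[][]}$: $[\mathbf x][\vec Y{=}\vec y]\varphi\leftrightarrow[\mathbf x',\vec Y{=}\vec y]\varphi$ for $\varphi\in\mathcal L_C$, where $\mathbf x'$ is the restriction of $\mathbf x$ to $\vec X\setminus\vec Y$. * The axioms of S5 for $K$: $K(\chi_1\to\chi_2)\to(K\chi_1\to K\chi_2)$, $K\chi\to\chi$, $K\chi\to KK\chi$, $\neg K\chi\to K\neg K\chi$. $KL$: $[\mathbf x]Y{=}y\to K[\mathbf x]Y{=}y$ for $Y\in\mathcal V$, $\vec X=\mathcal W\setminus\{Y\}$. * $[\alpha!][\mathbf x]Y{=}y\leftrightarrow(\alpha\to[\mathbf x]Y{=}y)$; $[\alpha!]\neg\chi\leftrightarrow(\alpha\to\neg[\alpha!]\chi)$; $[\alpha!](\chi_1\wedge\chi_2)\leftrightarrow([\alpha!]\chi_1\wedge[\alpha!]\chi_2)$; $[\alpha!]K\chi\leftrightarrow(\alpha\to K(\alpha\to[\alpha!]\chi))$; $[\alpha_1!][\alpha_2!]\chi\leftrightarrow[\alpha_1\wedge[\alpha_1!]\alpha_2!]\chi$;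 $[\alpha!](\chi_1\to\chi_2)\to([\alpha!]\chi_1\to[\alpha!]\chi_2)$; from $\alpha_1\leftrightarrow\alpha_2$ infer $[\alpha_1!]\chi\leftrightarrow[\alpha_2!]\chi$; $[\mathbf x][\alpha!]\chi\leftrightarrow[[\mathbf x]\alpha!][\mathbf x]\chi$. * $OC$: $[\mathbf x]\bigvee_{\vec o\in\mathcal R(\mathcal O)}K(\mathcal O{=}\vec o)$. $PD$: $[\mathbf x]K\psi\leftrightarrow\bigvee_{\vec o\in\mathcal R(\mathcal O)}\big([\mathbf x]\mathcal O{=}\vec o\wedge[[\mathbf x]\mathcal O{=}\vec o\,!]K[\mathbf x]\psi\big)$. Here $\mathcal O{=}\vec o$ is the conjunction of all $O{=}o$. Both are also taken without any intervention: $\bigvee_{\vec o}K(\mathcal O{=}\vec o)$ and $K\psi\leftrightarrow\bigvee_{\vec o}(\mathcal O{=}\vec o\wedge[\mathcal O{=}\vec o\,!]K\psi)$. Write $\Gamma\vdash\varphi$ if $(\gamma_1\wedge\dots\wedge\gamma_n)\to\varphi$ is a theorem of the system for some $\gamma_1,\dots,\gamma_n\in\Gamma$ ($n\geq 0$). **Theorem.**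 $\mathsf L^O_{PAKC}$ is sound and strongly complete for $\mathcal L_{PAKC}$ over epistemic (recursive) causal models with observables of signature $\mathscr S$: for every set $\Gamma\cup\{\varphi\}$ of $\mathcal L_{PAKC}$-formulas, $$\Gamma\models^O\varphi\quad\Longleftrightarrow\quad\Gamma\vdash\varphi .$$ -/

import Mathlib

universe u v w

namespace ObsCausal

/-! ## Signatures, valuations, assignments -/

/-- A finite signature with observables: exogenous variables `U`, endogenous variables `V`, a finite
non-empty range for every variable in the disjoint union of `U` and `V`, and a set `O` of
variables, the observables. -/
structure Signature where
  U : Type u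
  V : Type v
  [fintypeU : Fintype U]
  [fintypeV : Fintype V]
  [decEqU : DecidableEq U]
  [decEqV : DecidableEq V]
  R : U ⊕ V → Type w
  [fintypeR : ∀ X, Fintype (R X)]
  [decEqR : ∀ X, DecidableEq (R X)]
  [nonemptyR : ∀ X, Nonempty (R X)]
  O : Finset (U ⊕ V)

attribute [instance] Signature.fintypeU Signature.fintypeV Signature.decEqU Signature.decEqV
  Signature.fintypeR Signature.decEqR Signature.nonemptyR

variable (S : Signature.{u, v, w})

/-- The set of all variables. -/
abbrev Signature.Var : Type (max u v) := S.U ⊕ S.V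

/-- Total valuations. -/
abbrev Valuation : Type (max u v w) := ∀ X : S.Var, S.R X

/-- Values for all variables other than `X`. -/
abbrev Others (X : S.Var) : Type (max u v w) := ∀ Z : {Z : S.Var // Z ≠ X}, S.R Z.1

/-- An assignment: a partial function giving values to the variables of its domain. -/
abbrev Assignment : Type (max u v w) := ∀ X : S.Var, Option (S.R X)

variable {S}

/-- The restriction of a valuation to the variables other than `X`. -/
def Valuation.others (A : Valuation S) (X : S.Var) : Others S X := fun Z => A Z.1

/-- The empty assignment. -/
def Assignment.empty : Assignment S := fun _ => none

/-- The assignment `x, Y = y`. -/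
def Assignment.insert (x : Assignment S) (Y : S.Var) (y : S.R Y) : Assignment S :=
  Function.update x Y (some y)

/-- The assignment `x', y`, where `x'` is the subassignment of `x` whose domain consists of the
variables that are not in the domain of `y`. -/
def Assignment.override (x y : Assignment S) : Assignment S := fun Z => (y Z).or (x Z)

/-- The assignment with domain all variables other than `X`, with the values given by `a`. -/
def Others.toAssignment {X : S.Var} (a : Others S X) : Assignment S :=
  fun Z => if h : Z = X then none else some (a ⟨Z, h⟩)

/-! ## Structural functions and interventions -/

variable (S) in
/-- A structural function for every endogenous variable; its arguments are the values of all
other variables. -/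
abbrev StructFuns : Type (max u v w) := ∀ V : S.V, Others S (Sum.inr V) → S.R (Sum.inr V)

/-- `X` directly causally affects `Y`: the variable `Y` is endogenous, `X ≠ Y`, and some change of
the value of `X` alone changes the value of the structural function of `Y`. -/
def StructFuns.DirectlyAffects (F : StructFuns S) (X Y : S.Var) : Prop :=
  X ≠ Y ∧ ∃ V : S.V, Y = Sum.inr V ∧
    ∃ a b : Others S (Sum.inr V), (∀ Z, Z.1 ≠ X → a Z = b Z) ∧ F V a ≠ F V b

/-- The transitive closure of direct causal dependency is a strict partial order, that is
(transitivity being automatic) asymmetric. -/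
def StructFuns.Recursive (F : StructFuns S) : Prop :=
  ∀ X Y : S.Var, Relation.TransGen F.DirectlyAffects X Y →
    ¬ Relation.TransGen F.DirectlyAffects Y X

/-- The valuation `A` complies with the structural functions `F`. -/
def StructFuns.Complies (F : StructFuns S) (A : Valuation S) : Prop :=
  ∀ V : S.V, A (Sum.inr V) = F V (A.others (Sum.inr V))

/-- The structural functions after the intervention `x`: constant for the endogenous variables in
the domain of `x`, unchanged for the others. -/
def StructFuns.intervene (F : StructFuns S) (x : Assignment S) : StructFuns S :=
  fun V a => (x (Sum.inr V)).getD (F V a)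

/-- The equations for the valuation `B` that results from `A` by the intervention `x`. -/
def IsPost (F : StructFuns S) (x : Assignment S) (A B : Valuation S) : Prop :=
  (∀ U : S.U, B (Sum.inl U) = (x (Sum.inl U)).getD (A (Sum.inl U))) ∧
    (F.intervene x).Complies B

open Classical in
/-- The valuation that results from `A` by the intervention `x`, that is the unique solution of
the equations `IsPost`, see `existsUnique_isPost` (the value is irrelevant if there is none, which
is never the case for recursive `F`). -/
noncomputable def post (F : StructFuns S) (x : Assignment S) (A : Valuation S) : Valuation S :=
  if h : ∃ B, IsPost F x A B then h.choose else A

/-- Interventions preserve recursiveness. -/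
theorem StructFuns.Recursive.intervene {F : StructFuns S} (hF : F.Recursive) (x : Assignment S) :
    (F.intervene x).Recursive := by
  have h1 : ∀ X Y, (F.intervene x).DirectlyAffects X Y → F.DirectlyAffects X Y := by
    rintro X Y ⟨hXY, V, hV, a, b, hab, hne⟩
    refine ⟨hXY, V, hV, a, b, hab, fun h => hne ?_⟩
    simp [StructFuns.intervene, h]
  intro X Y hX hY
  exact hF X Y (Relation.TransGen.mono h1 _ _ hX) (Relation.TransGen.mono h1 _ _ hY)

theorem StructFuns.Recursive.wellFounded {F : StructFuns S} (hF : F.Recursive) :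
    WellFounded F.DirectlyAffects := by
  have : Std.Irrefl (Relation.TransGen F.DirectlyAffects) := ⟨fun X h => hF X X h h⟩
  have : IsTrans S.Var (Relation.TransGen F.DirectlyAffects) :=
    ⟨fun _ _ _ h h' => Relation.TransGen.trans h h'⟩
  have h := Finite.wellFounded_of_trans_of_irrefl (Relation.TransGen F.DirectlyAffects)
  exact Subrelation.wf (fun h => Relation.TransGen.single h) h

/-- A structural function depends only on the direct causes of its variable. -/
theorem StructFuns.eq_of_eq_on_parents (F : StructFuns S) (V : S.V)
    (a b : Others S (Sum.inr V))
    (h : ∀ Z, F.DirectlyAffects Z.1 (Sum.inr V) → a Z = b Z) : F V a = F V b := by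
  classical
  have key : ∀ s : Finset {Z : S.Var // Z ≠ Sum.inr V},
      F V (fun Z => if Z ∈ s then b Z else a Z) = F V a := by
    intro s
    induction s using Finset.induction_on with
    | empty => simp
    | insert Z s hZ ih =>
      rw [← ih]
      by_contra hne
      have hp : F.DirectlyAffects Z.1 (Sum.inr V) := by
        refine ⟨Z.2, V, rfl, _, _, ?_, hne⟩
        intro Y hY
        have hYZ : Y ≠ Z := fun e => hY (by rw [e])
        simp [hYZ]
      apply hne
      congr 1
      funext Y
      by_cases hYZ : Y = Z
      · subst hYZ
        simp [h Y hp]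
      · simp [hYZ]
  have h' := key Finset.univ
  simpa using h'.symm

/-- For recursive structural functions the result of an intervention exists and is unique. -/
theorem existsUnique_isPost {F : StructFuns S} (hF : F.Recursive) (x : Assignment S)
    (A : Valuation S) : ∃! B, IsPost F x A B := by
  classical
  set G := F.intervene x with hG
  have wf : WellFounded G.DirectlyAffects := (hF.intervene x).wellFounded
  let step : ∀ Y : S.Var, (∀ Z : S.Var, G.DirectlyAffects Z Y → S.R Z) → S.R Y := fun Y =>
    match Y with
    | Sum.inl U => fun _ => (x (Sum.inl U)).getD (A (Sum.inl U))
    | Sum.inr V => fun f => G V (fun Z =>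
        if h : G.DirectlyAffects Z.1 (Sum.inr V) then f Z.1 h else Classical.arbitrary _)
  let B : Valuation S := wf.fix step
  have hB : ∀ Y, B Y = step Y (fun Z _ => B Z) := fun Y => wf.fix_eq step Y
  refine ⟨B, ⟨fun U => ?_, fun V => ?_⟩, fun C hC => ?_⟩
  · exact hB (Sum.inl U)
  · refine (hB (Sum.inr V)).trans ?_
    refine G.eq_of_eq_on_parents V _ _ fun Z hZ => ?_
    simp [hZ, Valuation.others]
  · funext Y
    induction Y using wf.induction with
    | _ Y ih =>
      rw [hB Y]
      match Y, ih with
      | Sum.inl U, _ => exact hC.1 U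
      | Sum.inr V, ih =>
        refine (hC.2 V).trans ?_
        refine G.eq_of_eq_on_parents V _ _ fun Z hZ => ?_
        simp [hZ, Valuation.others, ih Z.1 hZ]

/-! ## Language -/

variable (S) in
/-- Formulas: `Y = y`, `¬ φ`, `φ ∧ ψ`, `K φ`, `[α!] φ`, `[x] φ`. -/
inductive Formula : Type (max u v w)
  | eq (Y : S.Var) (y : S.R Y) : Formula
  | neg (φ : Formula) : Formula
  | and (φ ψ : Formula) : Formula
  | know (φ : Formula) : Formula
  | announce (α φ : Formula) : Formula
  | intervene (x : Assignment S) (φ : Formula) : Formula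

namespace Formula

/-- `φ ∨ ψ`. -/
def or (φ ψ : Formula S) : Formula S := neg (and (neg φ) (neg ψ))

/-- `φ → ψ`. -/
def imp (φ ψ : Formula S) : Formula S := neg (and φ (neg ψ))

/-- `φ ↔ ψ`. -/
def iff (φ ψ : Formula S) : Formula S := and (imp φ ψ) (imp ψ φ)

variable [Nonempty S.Var]

/-- `⊤`, as a tautology on some atom. -/
noncomputable def top : Formula S :=
  imp (eq (Classical.arbitrary S.Var) (Classical.arbitrary _))
    (eq (Classical.arbitrary S.Var) (Classical.arbitrary _))

/-- `⊥`. -/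
noncomputable def bot : Formula S := neg top

/-- Finite conjunctions. -/
noncomputable def bigAnd (l : List (Formula S)) : Formula S := l.foldr and top

/-- Finite disjunctions. -/
noncomputable def bigOr (l : List (Formula S)) : Formula S := l.foldr or bot

/-- Disjunctions over a finite type. -/
noncomputable def disj {ι : Type*} [Fintype ι] (f : ι → Formula S) : Formula S :=
  bigOr ((Finset.univ : Finset ι).toList.map f)

variable (S) in
/-- Tuples of values for the observables. -/
abbrev ObsValues : Type (max u v w) := ∀ X : {X : S.Var // X ∈ S.O}, S.R X.1

/-- The conjunction saying that the tuple of observables has the value `o`. -/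
noncomputable def obsEq (o : ObsValues S) : Formula S :=
  bigAnd ((Finset.univ : Finset {X : S.Var // X ∈ S.O}).toList.map fun X => eq X.1 (o X))

/-- The formula `X ⇝ Y` expressing direct causal dependency: the disjunction of all
`[z, X = x₁] Y = y₁ ∧ [z, X = x₂] Y = y₂`, where `x₁ ≠ x₂`, `y₁ ≠ y₂` and `z` gives values to all
variables other than `X` and `Y`. The two assignments are written as two tuples of values for the
variables other than `Y` which differ in `X` and only there. In particular the
disjunction is empty, that is `⊥`, for `X = Y`. -/
noncomputable def affects (X Y : S.Var) : Formula S :=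
  open Classical in disj fun t : {t : (Others S Y × Others S Y) × (S.R Y × S.R Y) //
      t.1.1 ≠ t.1.2 ∧ (∀ Z, Z.1 ≠ X → t.1.1 Z = t.1.2 Z) ∧ t.2.1 ≠ t.2.2} =>
    and (intervene t.1.1.1.toAssignment (eq Y t.1.2.1))
      (intervene t.1.1.2.toAssignment (eq Y t.1.2.2))

/-- Formulas of the causal language: no knowledge and no announcement operators. -/
def IsCausal : Formula S → Prop
  | eq _ _ => True
  | neg φ => φ.IsCausal
  | and φ ψ => φ.IsCausal ∧ ψ.IsCausal
  | know _ => False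
  | announce _ _ => False
  | intervene _ φ => φ.IsCausal

/-- Instances of propositional tautologies: formulas that are true under every assignment of truth
values to all formulas that respects negation and conjunction. -/
def IsTautology (φ : Formula S) : Prop :=
  ∀ t : Formula S → Prop, (∀ ψ, t (neg ψ) ↔ ¬ t ψ) → (∀ ψ χ, t (and ψ χ) ↔ t ψ ∧ t χ) → t φ

end Formula

/-! ## Semantics with observables -/

/-- The epistemic state after the intervention `x` if `A` is the actual valuation: the results of
the intervention that agree with the actual result on the observables. -/
def postTeam (F : StructFuns S) (x : Assignment S) (T : Set (Valuation S)) (A : Valuation S) :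
    Set (Valuation S) :=
  {B | (∃ C ∈ T, B = post F x C) ∧ ∀ X ∈ S.O, B X = post F x A X}

/-- Satisfaction of a formula in the structural functions `F` and the epistemic state `T` at the
valuation `A`. -/
def Sat : Formula S → StructFuns S → Set (Valuation S) → Valuation S → Prop
  | .eq Y y, _, _, A => A Y = y
  | .neg φ, F, T, A => ¬ Sat φ F T A
  | .and φ ψ, F, T, A => Sat φ F T A ∧ Sat ψ F T A
  | .know φ, F, T, _ => ∀ B ∈ T, Sat φ F T B
  | .announce α φ, F, T, A => Sat α F T A → Sat φ F {B | B ∈ T ∧ Sat α F T B} A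
  | .intervene x φ, F, T, A => Sat φ (F.intervene x) (postTeam F x T A) (post F x A)

variable (S) in
/-- Epistemic (recursive) causal models with observables. -/
structure EpistemicModel where
  F : StructFuns S
  T : Set (Valuation S)
  recursive : F.Recursive
  nonempty : T.Nonempty
  complies : ∀ A ∈ T, F.Complies A
  obs_const : ∀ A ∈ T, ∀ B ∈ T, ∀ X ∈ S.O, A X = B X

/-- Semantic consequence over epistemic causal models with observables. -/
def Entails (Γ : Set (Formula S)) (φ : Formula S) : Prop :=
  ∀ (M : EpistemicModel S) (A : Valuation S), A ∈ M.T →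
    (∀ γ ∈ Γ, Sat γ M.F M.T A) → Sat φ M.F M.T A

/-! ## The axiom system -/

open Formula in
/-- Theorems of the axiom system with observables. -/
inductive Provable [Nonempty S.Var] : Formula S → Prop
  -- propositional logic
  | taut (φ : Formula S) : φ.IsTautology → Provable φ
  | mp (φ ψ : Formula S) : Provable φ → Provable (imp φ ψ) → Provable ψ
  -- interventions
  | a1 (x : Assignment S) (Y : S.Var) (y y' : S.R Y) : y ≠ y' →
      Provable (imp (intervene x (eq Y y)) (neg (intervene x (eq Y y'))))
  | a2 (x : Assignment S) (Y : S.Var) :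
      Provable (disj fun y : S.R Y => intervene x (eq Y y))
  | a3 (x : Assignment S) (Y Z : S.Var) (y : S.R Y) (z : S.R Z) : x Y = none →
      Provable (imp (and (intervene x (eq Y y)) (intervene x (eq Z z)))
        (intervene (x.insert Y y) (eq Z z)))
  | a4 (x : Assignment S) (Y : S.Var) (y : S.R Y) : x Y = none →
      Provable (intervene (x.insert Y y) (eq Y y))
  | a5 (x : Assignment S) (Y Z : S.Var) (y : S.R Y) (z : S.R Z) :
      x Y = none → x Z = none → Y ≠ Z →
      Provable (imp (and (intervene (x.insert Y y) (eq Z z)) (intervene (x.insert Z z) (eq Y y)))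
        (intervene x (eq Z z)))
  | a6 (k : ℕ) (X : Fin (k + 1) → S.Var) :
      Provable (imp (bigAnd (List.ofFn fun i : Fin k => affects (X i.castSucc) (X i.succ)))
        (neg (affects (X (Fin.last k)) (X 0))))
  | a7 (x : Assignment S) (U : S.U) (y : S.R (Sum.inl U)) : x (Sum.inl U) = none →
      Provable (iff (intervene Assignment.empty (eq (Sum.inl U) y)) (intervene x (eq (Sum.inl U) y)))
  | a_empty (Y : S.Var) (y : S.R Y) :
      Provable (iff (eq Y y) (intervene Assignment.empty (eq Y y)))
  | a_neg (x : Assignment S) (φ : Formula S) :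
      Provable (iff (intervene x (neg φ)) (neg (intervene x φ)))
  | a_and (x : Assignment S) (φ ψ : Formula S) :
      Provable (iff (intervene x (and φ ψ)) (and (intervene x φ) (intervene x ψ)))
  -- only for formulas of the causal language: successive interventions may provide more observations
  -- than a single one, so the equivalence fails for formulas about knowledge
  | a_comp (x y : Assignment S) (φ : Formula S) : φ.IsCausal →
      Provable (iff (intervene x (intervene y φ)) (intervene (x.override y) φ))
  -- knowledge
  | k (φ ψ : Formula S) : Provable (imp (know (imp φ ψ)) (imp (know φ) (know ψ)))
  | t (φ : Formula S) : Provable (imp (know φ) φ)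
  | four (φ : Formula S) : Provable (imp (know φ) (know (know φ)))
  | five (φ : Formula S) : Provable (imp (neg (know φ)) (know (neg (know φ))))
  | nec_know (φ : Formula S) : Provable φ → Provable (know φ)
  | kl (V : S.V) (a : Others S (Sum.inr V)) (y : S.R (Sum.inr V)) :
      Provable (imp (intervene a.toAssignment (eq (Sum.inr V) y))
        (know (intervene a.toAssignment (eq (Sum.inr V) y))))
  -- necessitation for interventions
  | nec_int (x : Assignment S) (φ : Formula S) : Provable φ → Provable (intervene x φ)
  -- announcements
  | ann_eq (α : Formula S) (x : Assignment S) (Y : S.Var) (y : S.R Y) :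
      Provable (iff (announce α (intervene x (eq Y y))) (imp α (intervene x (eq Y y))))
  | ann_neg (α φ : Formula S) :
      Provable (iff (announce α (neg φ)) (imp α (neg (announce α φ))))
  | ann_and (α φ ψ : Formula S) :
      Provable (iff (announce α (and φ ψ)) (and (announce α φ) (announce α ψ)))
  | ann_know (α φ : Formula S) :
      Provable (iff (announce α (know φ)) (imp α (know (imp α (announce α φ)))))
  | ann_ann (α β φ : Formula S) :
      Provable (iff (announce α (announce β φ)) (announce (and α (announce α β)) φ))
  | ann_k (α φ ψ : Formula S) :
      Provable (imp (announce α (imp φ ψ)) (imp (announce α φ) (announce α ψ)))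
  | nec_ann (α φ : Formula S) : Provable φ → Provable (announce α φ)
  | ann_re (α β φ : Formula S) : Provable (iff α β) →
      Provable (iff (announce α φ) (announce β φ))
  | int_ann (x : Assignment S) (α φ : Formula S) :
      Provable (iff (intervene x (announce α φ)) (announce (intervene x α) (intervene x φ)))
  -- observables; each axiom also in the form where no variable is intervened on, i.e. without the
  -- intervention operators
  | oc (x : Assignment S) :
      Provable (intervene x (disj fun o : ObsValues S => know (obsEq o)))
  | oc_nil : Provable (disj fun o : ObsValues S => know (obsEq o))
  | pd (x : Assignment S) (φ : Formula S) :
      Provable (iff (intervene x (know φ))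
        (disj fun o : ObsValues S => and (intervene x (obsEq o))
          (announce (intervene x (obsEq o)) (know (intervene x φ)))))
  | pd_nil (φ : Formula S) :
      Provable (iff (know φ)
        (disj fun o : ObsValues S => and (obsEq o) (announce (obsEq o) (know φ))))

/-- Derivability from a set of premises: some finite conjunction of premises provably implies the
formula. -/
def Derivable [Nonempty S.Var] (Γ : Set (Formula S)) (φ : Formula S) : Prop :=
  ∃ l : List (Formula S), (∀ ψ ∈ l, ψ ∈ Γ) ∧ Provable (Formula.imp (Formula.bigAnd l) φ)

end ObsCausal

namespace ObsCausal

variable {S : Signature.{u, v, w}}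

/-! Soundness is an induction on derivations over all models at once, since necessitation for
interventions and announcements moves to another model. The delicate case is $PD$
(`sat_intervene_know_iff`): announcing what would be observed after $\vec X=\vec x$ deletes exactly
the valuations that the intervention would discard.

For completeness, take worlds, that is, maximal consistent sets seen as truth assignments. The
axioms make $[\mathbf x]$ commute with negation and conjunction, so $\{\chi : [\mathbf x]\chi\in
a\}$ is again a world; likewise for $[\alpha!]$ if $\alpha\in a$. The truth lemma
`World.holds_iff_sat` is therefore a plain structural induction, with no translation into a smaller
language: the induction hypothesis for $\chi$ is applied at the transformed world.

Each world $a$ has a valuation, structural functions (read off from interventions on all variables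
but one) and a team, the valuations of its S5-accessible worlds. It remains to show that
transforming the world transforms these data as the semantics prescribes. `isPost_val_intervene`
shows that the intervened valuation solves the equations, and recursiveness, which comes from $A_6$,
makes the solution unique. $KL$ makes the functions constant on accessible worlds. Membership of a
valuation in the team is expressed by one formula (`mem_team_iff`), so the teams after announcements
and interventions can be computed from the axiom for $[\alpha!]K$ and from $PD$
(`mem_team_announce_iff`, `team_intervene`). -/

/-! ## Truth assignments -/

/-- A truth assignment to all formulas that respects negation and conjunction. -/
structure Formula.IsBoolean (t : Formula S → Prop) : Prop where
  neg : ∀ φ, t (.neg φ) ↔ ¬ t φ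
  and : ∀ φ ψ, t (.and φ ψ) ↔ t φ ∧ t ψ

namespace Formula.IsBoolean

variable {t : Formula S → Prop} (ht : IsBoolean t)
include ht

theorem imp (φ ψ : Formula S) : t (.imp φ ψ) ↔ (t φ → t ψ) := by
  simp [Formula.imp, ht.neg, ht.and]

theorem or (φ ψ : Formula S) : t (.or φ ψ) ↔ (t φ ∨ t ψ) := by
  simp only [Formula.or, ht.neg, ht.and]
  tauto

theorem iff (φ ψ : Formula S) : t (.iff φ ψ) ↔ (t φ ↔ t ψ) := by
  simp only [Formula.iff, ht.imp, ht.and]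
  tauto

variable [Nonempty S.Var]

theorem top : t .top := by
  simp [Formula.top, ht.imp]

theorem bot : ¬ t .bot := by
  simp [Formula.bot, ht.neg, ht.top]

theorem bigAnd (l : List (Formula S)) : t (.bigAnd l) ↔ ∀ φ ∈ l, t φ := by
  induction l with
  | nil => simpa [Formula.bigAnd] using ht.top
  | cons φ l ih =>
    simp only [Formula.bigAnd, List.foldr_cons, List.forall_mem_cons] at ih ⊢
    rw [ht.and, ih]

theorem bigOr (l : List (Formula S)) : t (.bigOr l) ↔ ∃ φ ∈ l, t φ := by
  induction l with
  | nil => simpa [Formula.bigOr] using ht.bot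
  | cons φ l ih =>
    simp only [Formula.bigOr, List.foldr_cons, List.exists_mem_cons_iff] at ih ⊢
    rw [ht.or, ih]

theorem disj {ι : Type*} [Fintype ι] (f : ι → Formula S) : t (.disj f) ↔ ∃ i, t (f i) := by
  simp [Formula.disj, ht.bigOr]

theorem obsEq (o : Formula.ObsValues S) : t (.obsEq o) ↔ ∀ X, t (.eq X.1 (o X)) := by
  simp only [Formula.obsEq, ht.bigAnd, List.forall_mem_map, Finset.mem_toList,
    Finset.mem_univ, true_imp_iff]

theorem affects (X Y : S.Var) : t (.affects X Y) ↔
    ∃ (a b : Others S Y) (y z : S.R Y), a ≠ b ∧ (∀ Z, Z.1 ≠ X → a Z = b Z) ∧ y ≠ z ∧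
      t (.intervene a.toAssignment (.eq Y y)) ∧ t (.intervene b.toAssignment (.eq Y z)) := by
  rw [Formula.affects, ht.disj]
  constructor
  · rintro ⟨⟨⟨⟨a, b⟩, y, z⟩, h1, h2, h3⟩, h⟩
    exact ⟨a, b, y, z, h1, h2, h3, (ht.and _ _).1 h⟩
  · rintro ⟨a, b, y, z, h1, h2, h3, h⟩
    exact ⟨⟨⟨⟨a, b⟩, y, z⟩, h1, h2, h3⟩, (ht.and _ _).2 h⟩

end Formula.IsBoolean

theorem isBoolean_sat (F : StructFuns S) (T : Set (Valuation S)) (A : Valuation S) :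
    Formula.IsBoolean fun φ => Sat φ F T A :=
  ⟨fun _ => Iff.rfl, fun _ _ => Iff.rfl⟩

/-! ## Assignments -/

theorem Others.toAssignment_self {X : S.Var} (a : Others S X) : a.toAssignment X = none := by
  simp [Others.toAssignment]

theorem Others.toAssignment_of_ne {X Y : S.Var} (a : Others S X) (h : Y ≠ X) :
    a.toAssignment Y = some (a ⟨Y, h⟩) := by
  simp [Others.toAssignment, h]

theorem Assignment.insert_self (x : Assignment S) (Y : S.Var) (y : S.R Y) :
    x.insert Y y Y = some y := by
  simp [Assignment.insert]

theorem Assignment.insert_of_ne (x : Assignment S) {Y Z : S.Var} (y : S.R Y) (h : Z ≠ Y) :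
    x.insert Y y Z = x Z := by
  simp [Assignment.insert, h]

theorem Assignment.exists_eq_insert {x : Assignment S} {Y : S.Var} {y : S.R Y}
    (h : x Y = some y) : ∃ z : Assignment S, z Y = none ∧ x = z.insert Y y := by
  refine ⟨Function.update x Y none, by simp, ?_⟩
  funext Z
  by_cases hZ : Z = Y
  · subst hZ
    simp [Assignment.insert, h]
  · simp [Assignment.insert, hZ]

theorem Assignment.override_toAssignment_of_none {x : Assignment S} {X : S.Var} (a : Others S X)
    (h : x X = none) : x.override a.toAssignment = a.toAssignment := by
  funext Z
  by_cases hZ : Z = X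
  · subst hZ
    simp [Assignment.override, a.toAssignment_self, h]
  · simp [Assignment.override, a.toAssignment_of_ne hZ]

theorem Assignment.override_toAssignment_of_some {x : Assignment S} {X : S.Var} {v : S.R X}
    (a : Others S X) (h : x X = some v) :
    x.override a.toAssignment = a.toAssignment.insert X v := by
  funext Z
  by_cases hZ : Z = X
  · subst hZ
    simp [Assignment.override, a.toAssignment_self, h, Assignment.insert]
  · simp [Assignment.override, a.toAssignment_of_ne hZ, Assignment.insert, hZ]

/-! ## Results of interventions -/

section Post

variable {F : StructFuns S} (hF : F.Recursive) {x : Assignment S} {A B : Valuation S}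

theorem IsPost.apply_of_some (h : IsPost F x A B) {Y : S.Var} {y : S.R Y} (hY : x Y = some y) :
    B Y = y := by
  match Y with
  | .inl U => rw [h.1 U, hY, Option.getD_some]
  | .inr V => rw [h.2 V, StructFuns.intervene, hY, Option.getD_some]

include hF

theorem isPost_post (x : Assignment S) (A : Valuation S) : IsPost F x A (post F x A) := by
  have h := (existsUnique_isPost hF x A).exists
  rw [post, dif_pos h]
  exact h.choose_spec

theorem IsPost.eq_post (h : IsPost F x A B) : B = post F x A :=
  (existsUnique_isPost hF x A).unique h (isPost_post hF x A)

theorem post_apply_of_some {Y : S.Var} {y : S.R Y} (hY : x Y = some y) (A : Valuation S) :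
    post F x A Y = y :=
  (isPost_post hF x A).apply_of_some hY

theorem post_inl_of_none {U : S.U} (hU : x (.inl U) = none) (A : Valuation S) :
    post F x A (.inl U) = A (.inl U) := by
  rw [(isPost_post hF x A).1 U, hU, Option.getD_none]

theorem post_inr_of_none {V : S.V} (hV : x (.inr V) = none) (A : Valuation S) :
    post F x A (.inr V) = F V ((post F x A).others (.inr V)) := by
  conv_lhs => rw [(isPost_post hF x A).2 V, StructFuns.intervene, hV, Option.getD_none]

theorem post_empty (hA : F.Complies A) : post F Assignment.empty A = A :=
  (IsPost.eq_post (x := .empty) hF ⟨fun _ => rfl, hA⟩).symm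

/-- The old solution also satisfies the new equation for `Y`, and solutions are unique. This is the
semantic content of $A_3$. -/
theorem post_insert {Y : S.Var} {y : S.R Y} (hy : post F x A Y = y) :
    post F (x.insert Y y) A = post F x A := by
  symm
  refine IsPost.eq_post hF ⟨fun U => ?_, fun V => ?_⟩
  · by_cases h : Sum.inl U = Y
    · subst h
      rw [Assignment.insert_self, Option.getD_some, hy]
    · rw [Assignment.insert_of_ne x y h]
      exact (isPost_post hF x A).1 U
  · rw [StructFuns.intervene]
    by_cases h : Sum.inr V = Y
    · subst h
      rw [Assignment.insert_self, Option.getD_some, hy]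
    · rw [Assignment.insert_of_ne x y h]
      exact (isPost_post hF x A).2 V

/-- Both interventions have the same result, namely that of setting `Y` and `Z` together. This
valuation solves the equations of `x` alone, since each variable is left untouched by one of the two
insertions. -/
theorem post_reversible {Y Z : S.Var} {y : S.R Y} {z : S.R Z} (hYZ : Y ≠ Z)
    (hz : post F (x.insert Y y) A Z = z) (hy : post F (x.insert Z z) A Y = y) :
    post F x A Z = z := by
  have h1 := post_insert hF hz
  have h2 := post_insert hF hy
  have h3 : (x.insert Y y).insert Z z = (x.insert Z z).insert Y y := by
    simp only [Assignment.insert]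
    exact Function.update_comm hYZ _ _ _
  have h12 : post F (x.insert Y y) A = post F (x.insert Z z) A := by
    rw [← h1, h3, h2]
  have hP : IsPost F x A (post F (x.insert Y y) A) := by
    have hB := isPost_post hF (x.insert Y y) A
    have hC := isPost_post hF (x.insert Z z) A
    rw [← h12] at hC
    refine ⟨fun U => ?_, fun V => ?_⟩
    -- The equation for `Y` comes from the intervention on `Z`, all other equations from the
    -- intervention on `Y`.
    · by_cases h : Sum.inl U = Y
      · have h' := hC.1 U
        rwa [Assignment.insert_of_ne x z (by rw [h]; exact hYZ)] at h'
      · have h' := hB.1 U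
        rwa [Assignment.insert_of_ne x y h] at h'
    · by_cases h : Sum.inr V = Y
      · have h' := hC.2 V
        rwa [StructFuns.intervene, Assignment.insert_of_ne x z (by rw [h]; exact hYZ)] at h'
      · have h' := hB.2 V
        rwa [StructFuns.intervene, Assignment.insert_of_ne x y h] at h'
  rw [← hP.eq_post hF, hz]

omit hF in
theorem StructFuns.intervene_intervene (F : StructFuns S) (x y : Assignment S) :
    (F.intervene x).intervene y = F.intervene (x.override y) := by
  funext V a
  simp only [StructFuns.intervene, Assignment.override]
  cases y (.inr V) <;> rfl

theorem post_post (x y : Assignment S) (A : Valuation S) :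
    post (F.intervene x) y (post F x A) = post F (x.override y) A := by
  have h := isPost_post (hF.intervene x) y (post F x A)
  refine IsPost.eq_post hF ⟨fun U => ?_, ?_⟩
  · rw [h.1 U, (isPost_post hF x A).1 U, Assignment.override]
    cases y (.inl U) <;> rfl
  · rw [← StructFuns.intervene_intervene]
    exact h.2

theorem post_toAssignment {V : S.V} (a : Others S (.inr V)) (A : Valuation S) :
    post F a.toAssignment A (.inr V) = F V a := by
  rw [post_inr_of_none hF a.toAssignment_self]
  congr 1
  funext Z
  exact post_apply_of_some hF (a.toAssignment_of_ne Z.2) A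

end Post

theorem StructFuns.Recursive.not_transGen_self {F : StructFuns S} (hF : F.Recursive) (X : S.Var) :
    ¬ Relation.TransGen F.DirectlyAffects X X :=
  fun h => hF X X h h

/-! ## Models after interventions and announcements -/

theorem post_mem_postTeam {F : StructFuns S} {x : Assignment S} {T : Set (Valuation S)}
    {A : Valuation S} (hA : A ∈ T) : post F x A ∈ postTeam F x T A :=
  ⟨⟨A, hA, rfl⟩, fun _ _ => rfl⟩

/-- The actual valuation enters the new epistemic state only through the observed outcomes. -/
theorem postTeam_congr {F : StructFuns S} {x : Assignment S} {T : Set (Valuation S)}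
    {A B : Valuation S} (h : ∀ X ∈ S.O, post F x A X = post F x B X) :
    postTeam F x T A = postTeam F x T B := by
  ext C
  exact and_congr_right fun _ => forall₂_congr fun X hX => by rw [h X hX]

/-- The model after the intervention `x`, if `A` is the actual valuation. -/
def EpistemicModel.intervene (M : EpistemicModel S) (x : Assignment S) (A : Valuation S)
    (hA : A ∈ M.T) : EpistemicModel S where
  F := M.F.intervene x
  T := postTeam M.F x M.T A
  recursive := M.recursive.intervene x
  nonempty := ⟨_, post_mem_postTeam hA⟩
  complies := by
    rintro _ ⟨⟨C, _, rfl⟩, _⟩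
    exact (isPost_post M.recursive x C).2
  obs_const := fun B hB C hC X hX => (hB.2 X hX).trans (hC.2 X hX).symm

/-- The submodel on a non-empty set of valuations. -/
def EpistemicModel.restrict (M : EpistemicModel S) (T : Set (Valuation S)) (hT : T ⊆ M.T)
    (hne : T.Nonempty) : EpistemicModel S where
  F := M.F
  T := T
  recursive := M.recursive
  nonempty := hne
  complies := fun A hA => M.complies A (hT hA)
  obs_const := fun A hA B hB => M.obs_const A (hT hA) B (hT hB)

/-- Only knowledge and announcements inspect the team. This is what makes $A_{[][]}$ sound although
two successive interventions may leave a smaller team than one. -/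
theorem Formula.IsCausal.sat_congr [Nonempty S.Var] {φ : Formula S} (hφ : φ.IsCausal) :
    ∀ (F : StructFuns S) (T T' : Set (Valuation S)) (A : Valuation S),
      Sat φ F T A ↔ Sat φ F T' A := by
  induction φ with
  | eq Y y => exact fun _ _ _ _ => Iff.rfl
  | neg φ ih => exact fun F T T' A => not_congr (ih hφ F T T' A)
  | and φ ψ ih1 ih2 =>
    exact fun F T T' A => and_congr (ih1 hφ.1 F T T' A) (ih2 hφ.2 F T T' A)
  | know φ => exact hφ.elim
  | announce α φ => exact hφ.elim
  | intervene x φ ih => exact fun F T T' A => ih hφ _ _ _ _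

/-! ## Soundness -/

section Soundness

variable [Nonempty S.Var]

/-- Fixing all variables but an endogenous one makes its value that of its structural function; an
exogenous variable just keeps its value, so it cannot be affected. -/
theorem directlyAffects_of_sat_affects {F : StructFuns S} (hF : F.Recursive)
    {T : Set (Valuation S)} {A : Valuation S} {X Y : S.Var} (h : Sat (.affects X Y) F T A) :
    F.DirectlyAffects X Y := by
  obtain ⟨a, b, y, z, hab, hX, hyz, h1, h2⟩ := ((isBoolean_sat F T A).affects X Y).1 h
  simp only [Sat] at h1 h2
  match Y with
  | .inl U =>
    rw [post_inl_of_none hF (Others.toAssignment_self _)] at h1 h2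
    exact (hyz (h1.symm.trans h2)).elim
  | .inr V =>
    rw [post_toAssignment hF] at h1 h2
    refine ⟨?_, V, rfl, a, b, hX, by rwa [h1, h2]⟩
    rintro rfl
    exact hab (funext fun Z => hX Z Z.2)

theorem sat_obsEq {F : StructFuns S} {T : Set (Valuation S)} {A : Valuation S}
    (o : Formula.ObsValues S) : Sat (.obsEq o) F T A ↔ ∀ X, A X.1 = o X :=
  (isBoolean_sat F T A).obsEq o

theorem sat_intervene_know_iff {F : StructFuns S} {T : Set (Valuation S)} {x : Assignment S}
    {A : Valuation S} (φ : Formula S) : Sat (.intervene x (.know φ)) F T A ↔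
      ∃ o : Formula.ObsValues S, Sat (.intervene x (.obsEq o)) F T A ∧
        Sat (.announce (.intervene x (.obsEq o)) (.know (.intervene x φ))) F T A := by
  -- Restricting beforehand to the valuations with observed outcome `o` does not change the team
  -- after the intervention, from whichever valuation with that outcome it is taken.
  have key : ∀ o : Formula.ObsValues S, (∀ X, post F x A X.1 = o X) →
      ∀ C, (∀ X, post F x C X.1 = o X) →
        postTeam F x {B | B ∈ T ∧ ∀ X, post F x B X.1 = o X} C = postTeam F x T A := by
    intro o hA C hC
    have hAC : ∀ X ∈ S.O, post F x C X = post F x A X := fun X hX =>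
      (hC ⟨X, hX⟩).trans (hA ⟨X, hX⟩).symm
    ext B
    constructor
    · rintro ⟨⟨D, ⟨hD, _⟩, rfl⟩, h⟩
      exact ⟨⟨D, hD, rfl⟩, fun X hX => (h X hX).trans (hAC X hX)⟩
    · rintro ⟨⟨D, hD, rfl⟩, h⟩
      exact ⟨⟨D, ⟨hD, fun X => (h X.1 X.2).trans (hA X)⟩, rfl⟩,
        fun X hX => (h X hX).trans (hAC X hX).symm⟩
  simp only [Sat, sat_obsEq]
  constructor
  · intro h
    refine ⟨fun X => post F x A X.1, fun X => rfl, fun _ C hC => ?_⟩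
    rw [key _ (fun _ => rfl) C hC.2]
    exact h _ ⟨⟨C, hC.1, rfl⟩, fun X hX => hC.2 ⟨X, hX⟩⟩
  · rintro ⟨o, hA, h⟩ _ ⟨⟨C, hC, rfl⟩, hCA⟩
    have hCo : ∀ X : {X : S.Var // X ∈ S.O}, post F x C X.1 = o X :=
      fun X => (hCA X.1 X.2).trans (hA X)
    have h' := h hA C ⟨hC, hCo⟩
    rwa [key o hA C hCo] at h'

theorem Provable.sound {φ : Formula S} (h : Provable φ) :
    ∀ (M : EpistemicModel S) (A : Valuation S), A ∈ M.T → Sat φ M.F M.T A := by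
  induction h with
  | taut φ h => exact fun M A _ => h (fun φ => Sat φ M.F M.T A) (fun _ => Iff.rfl) fun _ _ => Iff.rfl
  | mp φ ψ _ _ ih1 ih2 =>
    exact fun M A hA => ((isBoolean_sat M.F M.T A).imp φ ψ).1 (ih2 M A hA) (ih1 M A hA)
  | a1 x Y y y' hy =>
    intro M A hA
    rw [(isBoolean_sat M.F M.T A).imp]
    exact fun h h' => hy (h.symm.trans h')
  | a2 x Y =>
    intro M A hA
    exact ((isBoolean_sat M.F M.T A).disj _).2 ⟨_, rfl⟩
  | a3 x Y Z y z hY =>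
    intro M A hA
    rw [(isBoolean_sat M.F M.T A).imp]
    rintro ⟨h1, h2⟩
    simp only [Sat] at h1 h2 ⊢
    rw [post_insert M.recursive h1, h2]
  | a4 x Y y hY =>
    exact fun M A hA => post_apply_of_some M.recursive (x.insert_self Y y) A
  | a5 x Y Z y z hY hZ hYZ =>
    intro M A hA
    rw [(isBoolean_sat M.F M.T A).imp]
    rintro ⟨h1, h2⟩
    exact post_reversible M.recursive hYZ h1 h2
  | a6 k X =>
    intro M A hA
    rw [(isBoolean_sat M.F M.T A).imp, (isBoolean_sat M.F M.T A).bigAnd]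
    intro h h'
    have h1 : ∀ i : Fin (k + 1), Relation.ReflTransGen M.F.DirectlyAffects (X 0) (X i) := by
      intro i
      -- The conjuncts give a path from `X 0` to every `X i`; the forbidden last arrow would close
      -- it to a cycle.
      induction i using Fin.induction with
      | zero => exact .refl
      | succ i ih =>
        exact ih.tail (directlyAffects_of_sat_affects M.recursive
          (h _ (List.mem_ofFn.2 ⟨i, rfl⟩)))
    exact M.recursive.not_transGen_self _ (Relation.TransGen.tail' (h1 (Fin.last k))
      (directlyAffects_of_sat_affects M.recursive h'))
  | a7 x U y hU =>
    intro M A hA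
    rw [(isBoolean_sat M.F M.T A).iff]
    simp only [Sat]
    rw [post_inl_of_none M.recursive hU, post_inl_of_none M.recursive rfl]
  | a_empty Y y =>
    intro M A hA
    rw [(isBoolean_sat M.F M.T A).iff]
    simp only [Sat]
    rw [post_empty M.recursive (M.complies A hA)]
  | a_neg x φ => exact fun M A hA => ((isBoolean_sat M.F M.T A).iff _ _).2 Iff.rfl
  | a_and x φ ψ => exact fun M A hA => ((isBoolean_sat M.F M.T A).iff _ _).2 Iff.rfl
  | a_comp x y φ hφ =>
    intro M A hA
    rw [(isBoolean_sat M.F M.T A).iff]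
    simp only [Sat]
    rw [post_post M.recursive, StructFuns.intervene_intervene]
    exact hφ.sat_congr _ _ _ _
  | k φ ψ =>
    intro M A hA
    rw [(isBoolean_sat M.F M.T A).imp, (isBoolean_sat M.F M.T A).imp]
    exact fun h h' B hB => ((isBoolean_sat M.F M.T B).imp φ ψ).1 (h B hB) (h' B hB)
  | t φ =>
    intro M A hA
    rw [(isBoolean_sat M.F M.T A).imp]
    exact fun h => h A hA
  | four φ =>
    intro M A hA
    rw [(isBoolean_sat M.F M.T A).imp]
    exact fun h B hB => h
  | five φ =>
    intro M A hA
    rw [(isBoolean_sat M.F M.T A).imp]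
    exact fun h B hB => h
  | nec_know φ _ ih => exact fun M A hA B hB => ih M B hB
  | kl V a y =>
    intro M A hA
    rw [(isBoolean_sat M.F M.T A).imp]
    intro h B hB
    simp only [Sat] at h ⊢
    rw [post_toAssignment M.recursive] at h ⊢
    exact h
  | nec_int x φ _ ih =>
    exact fun M A hA => ih (M.intervene x A hA) _ (post_mem_postTeam hA)
  | ann_eq α x Y y =>
    intro M A hA
    rw [(isBoolean_sat M.F M.T A).iff, (isBoolean_sat M.F M.T A).imp]
    exact Iff.rfl
  | ann_neg α φ =>
    intro M A hA
    rw [(isBoolean_sat M.F M.T A).iff, (isBoolean_sat M.F M.T A).imp]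
    simp only [Sat]
    tauto
  | ann_and α φ ψ =>
    intro M A hA
    rw [(isBoolean_sat M.F M.T A).iff]
    simp only [Sat]
    tauto
  | ann_know α φ =>
    intro M A hA
    rw [(isBoolean_sat M.F M.T A).iff, (isBoolean_sat M.F M.T A).imp]
    refine imp_congr_right fun _ => forall_congr' fun B => ?_
    rw [(isBoolean_sat M.F M.T B).imp]
    simp only [Sat, Set.mem_ofPred_eq]
    tauto
  | ann_ann α β φ =>
    intro M A hA
    rw [(isBoolean_sat M.F M.T A).iff]
    simp only [Sat, Set.mem_ofPred_eq]
    have : {B | (B ∈ M.T ∧ Sat α M.F M.T B) ∧ Sat β M.F {B | B ∈ M.T ∧ Sat α M.F M.T B} B} =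
        {B | B ∈ M.T ∧ Sat α M.F M.T B ∧
          (Sat α M.F M.T B → Sat β M.F {B | B ∈ M.T ∧ Sat α M.F M.T B} B)} := by
      ext B
      simp only [Set.mem_ofPred_eq]
      tauto
    rw [this]
    tauto
  | ann_k α φ ψ =>
    intro M A hA
    rw [(isBoolean_sat M.F M.T A).imp, (isBoolean_sat M.F M.T A).imp]
    simp only [Sat]
    exact fun h h' hα => ((isBoolean_sat M.F _ A).imp φ ψ).1 (h hα) (h' hα)
  | nec_ann α φ _ ih =>
    exact fun M A hA hα => ih (M.restrict {B | B ∈ M.T ∧ Sat α M.F M.T B} (fun B hB => hB.1)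
      ⟨A, hA, hα⟩) A ⟨hA, hα⟩
  | ann_re α β φ _ ih =>
    intro M A hA
    rw [(isBoolean_sat M.F M.T A).iff]
    have h : ∀ B ∈ M.T, (Sat α M.F M.T B ↔ Sat β M.F M.T B) := fun B hB =>
      ((isBoolean_sat M.F M.T B).iff α β).1 (ih M B hB)
    have h' : {B | B ∈ M.T ∧ Sat α M.F M.T B} = {B | B ∈ M.T ∧ Sat β M.F M.T B} := by
      ext B
      exact and_congr_right (h B)
    simp only [Sat]
    rw [h A hA, h']
  | int_ann x α φ =>
    intro M A hA
    rw [(isBoolean_sat M.F M.T A).iff]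
    simp only [Sat]
    -- Intervening and announcing commute: valuations with the same observed outcome as `A` evaluate
    -- `α` in the same post-intervention team.
    have : postTeam M.F x {B | B ∈ M.T ∧
          Sat α (M.F.intervene x) (postTeam M.F x M.T B) (post M.F x B)} A =
        {B | B ∈ postTeam M.F x M.T A ∧
          Sat α (M.F.intervene x) (postTeam M.F x M.T A) B} := by
      ext B
      constructor
      · rintro ⟨⟨C, ⟨hC, hα⟩, rfl⟩, h⟩
        rw [postTeam_congr h] at hα
        exact ⟨⟨⟨C, hC, rfl⟩, h⟩, hα⟩
      · rintro ⟨⟨⟨C, hC, rfl⟩, h⟩, hα⟩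
        rw [← postTeam_congr h] at hα
        exact ⟨⟨C, ⟨hC, hα⟩, rfl⟩, h⟩
    rw [this]
  | oc x =>
    intro M A hA
    refine ((isBoolean_sat _ _ _).disj _).2 ⟨fun X => post M.F x A X.1, fun B hB => ?_⟩
    exact (sat_obsEq _).2 fun X => hB.2 X.1 X.2
  | oc_nil =>
    intro M A hA
    refine ((isBoolean_sat _ _ _).disj _).2 ⟨fun X => A X.1, fun B hB => ?_⟩
    exact (sat_obsEq _).2 fun X => M.obs_const B hB A hA X.1 X.2
  | pd x φ =>
    intro M A hA
    rw [(isBoolean_sat M.F M.T A).iff, (isBoolean_sat M.F M.T A).disj]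
    exact sat_intervene_know_iff φ
  | pd_nil φ =>
    intro M A hA
    rw [(isBoolean_sat M.F M.T A).iff, (isBoolean_sat M.F M.T A).disj]
    -- The observables are constant on the team, so announcing their true values deletes nothing.
    have h : ∀ o : Formula.ObsValues S, Sat (.obsEq o) M.F M.T A →
        {B | B ∈ M.T ∧ Sat (.obsEq o) M.F M.T B} = M.T := by
      intro o ho
      ext B
      refine and_iff_left_of_imp fun hB => (sat_obsEq o).2 fun X => ?_
      rw [M.obs_const B hB A hA X.1 X.2]
      exact (sat_obsEq o).1 ho X
    constructor
    · intro hφ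
      have ho : Sat (.obsEq fun X : {X : S.Var // X ∈ S.O} => A X.1) M.F M.T A :=
        (sat_obsEq _).2 fun X => rfl
      refine ⟨_, ho, fun _ => ?_⟩
      rwa [h _ ho]
    · rintro ⟨o, ho, h'⟩
      have h' := h' ho
      rwa [h _ ho] at h'

end Soundness

/-! ## Worlds -/

section Worlds

variable [Nonempty S.Var]

/-- The formula that says that the valuation is `A`. -/
noncomputable def Formula.valEq (A : Valuation S) : Formula S :=
  .bigAnd ((Finset.univ : Finset S.Var).toList.map fun X => .eq X (A X))

/-- Truth assignments under which all theorems are true, that is, the characteristic functions of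
maximal consistent sets. -/
structure IsWorld (t : Formula S → Prop) : Prop extends Formula.IsBoolean t where
  provable : ∀ φ, Provable φ → t φ

theorem Derivable.of_provable {Γ : Set (Formula S)} {φ : Formula S} (h : Provable φ) :
    Derivable Γ φ := by
  refine ⟨[], by simp, .mp _ _ h (.taut _ fun t hn ha => ?_)⟩
  have ht : Formula.IsBoolean t := ⟨hn, ha⟩
  simp only [ht.imp]
  tauto

theorem Derivable.of_mem {Γ : Set (Formula S)} {φ : Formula S} (h : φ ∈ Γ) : Derivable Γ φ := by
  refine ⟨[φ], by simpa using h, .taut _ fun t hn ha => ?_⟩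
  have ht : Formula.IsBoolean t := ⟨hn, ha⟩
  simp [ht.imp, ht.bigAnd]

theorem Derivable.mp {Γ : Set (Formula S)} {φ ψ : Formula S} (h : Derivable Γ φ)
    (h' : Derivable Γ (.imp φ ψ)) : Derivable Γ ψ := by
  obtain ⟨l, hl, h⟩ := h
  obtain ⟨l', hl', h'⟩ := h'
  refine ⟨l ++ l', fun χ hχ => (List.mem_append.1 hχ).elim (hl χ) (hl' χ),
    .mp _ _ h' (.mp _ _ h (.taut _ fun t hn ha => ?_))⟩
  have ht : Formula.IsBoolean t := ⟨hn, ha⟩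
  simp only [ht.imp, ht.bigAnd, List.mem_append]
  intro h1 h2 h3
  exact h2 (fun χ hχ => h3 χ (.inr hχ)) (h1 fun χ hχ => h3 χ (.inl hχ))

theorem Derivable.imp_of_insert {Γ : Set (Formula S)} {φ ψ : Formula S}
    (h : Derivable (insert φ Γ) ψ) : Derivable Γ (.imp φ ψ) := by
  classical
  obtain ⟨l, hl, h⟩ := h
  refine ⟨l.filter (· ≠ φ), fun χ hχ => ?_, .mp _ _ h (.taut _ fun t hn ha => ?_)⟩
  · simp only [ne_eq, decide_not, List.mem_filter, Bool.not_eq_eq_eq_not, Bool.not_true,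
      decide_eq_false_iff_not] at hχ
    exact (hl χ hχ.1).resolve_left hχ.2
  · have ht : Formula.IsBoolean t := ⟨hn, ha⟩
    simp only [ht.imp, ht.bigAnd]
    intro h1 h2 h3
    refine h1 fun χ hχ => ?_
    by_cases he : χ = φ
    · rwa [he]
    · exact h2 χ (by simp [hχ, he])

/-- Lindenbaum's lemma: a formula that is not derivable fails at some world at which all the
premises hold. -/
theorem exists_isWorld_of_not_derivable {Γ : Set (Formula S)} {φ : Formula S}
    (h : ¬ Derivable Γ φ) : ∃ t, IsWorld t ∧ (∀ γ ∈ Γ, t γ) ∧ ¬ t φ := by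
  obtain ⟨Δ, hΓΔ, hΔ⟩ := zorn_subset_nonempty {Δ : Set (Formula S) | ¬ Derivable Δ φ} (by
    intro c hc hchain hne
    refine ⟨⋃₀ c, ?_, fun s hs => Set.subset_sUnion_of_mem hs⟩
    rintro ⟨l, hl, hlφ⟩
    have hs : ∃ s ∈ c, ∀ ψ ∈ l, ψ ∈ s := by
      clear hlφ
      induction l with
      | nil => exact hne.imp fun s hs => ⟨hs, by simp⟩
      | cons ψ l ih =>
        obtain ⟨s, hs, hsl⟩ := ih fun χ hχ => hl χ (List.mem_cons_of_mem _ hχ)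
        obtain ⟨s', hs', hψ⟩ := hl ψ List.mem_cons_self
        rcases hchain.total hs hs' with hss | hss
        · exact ⟨s', hs', List.forall_mem_cons.2 ⟨hψ, fun χ hχ => hss (hsl χ hχ)⟩⟩
        · exact ⟨s, hs, List.forall_mem_cons.2 ⟨hss hψ, hsl⟩⟩
    obtain ⟨s, hs, hsl⟩ := hs
    exact hc hs ⟨l, hsl, hlφ⟩) Γ h
  have hφ : ¬ Derivable Δ φ := hΔ.prop
  -- By maximality, adding any formula outside `Δ` makes `φ` derivable. This yields closure under
  -- derivability, and completeness for negation by a case distinction.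
  have hinsert : ∀ ψ, ψ ∉ Δ → Derivable Δ (.imp ψ φ) := by
    intro ψ hψ
    by_contra hcon
    refine hψ (hΔ.le_of_ge (y := insert ψ Δ) (fun h' => hcon h'.imp_of_insert)
      (Set.subset_insert _ _) (Set.mem_insert _ _))
  have hclosed : ∀ ψ, Derivable Δ ψ → ψ ∈ Δ := by
    intro ψ hψ
    by_contra hcon
    exact hφ (hψ.mp (hinsert ψ hcon))
  have htaut : ∀ ψ : Formula S, ψ.IsTautology → Derivable Δ ψ := fun ψ hψ =>
    .of_provable (.taut _ hψ)
  refine ⟨(· ∈ Δ), ⟨⟨fun ψ => ⟨fun h1 h2 => ?_, fun h1 => ?_⟩, fun ψ χ => ⟨fun h1 => ?_,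
    fun h1 => ?_⟩⟩, fun ψ hψ => hclosed ψ (.of_provable hψ)⟩, fun γ hγ => hΓΔ hγ,
    fun h' => hφ (.of_mem h')⟩
  · refine hφ ((Derivable.of_mem h2).mp ((Derivable.of_mem h1).mp (htaut _ fun t hn ha => ?_)))
    simp only [Formula.IsBoolean.imp ⟨hn, ha⟩, hn]
    tauto
  · by_contra h2
    refine hφ ((hinsert _ h1).mp ((hinsert _ h2).mp (htaut _ fun t hn ha => ?_)))
    simp only [Formula.IsBoolean.imp ⟨hn, ha⟩, hn]
    tauto
  · constructor <;> refine hclosed _ ((Derivable.of_mem h1).mp (htaut _ fun t hn ha => ?_)) <;>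
    · simp only [Formula.IsBoolean.imp ⟨hn, ha⟩, ha]
      tauto
  · refine hclosed _ ((Derivable.of_mem h1.1).mp ((Derivable.of_mem h1.2).mp
      (htaut _ fun t hn ha => ?_)))
    simp only [Formula.IsBoolean.imp ⟨hn, ha⟩, ha]
    tauto

variable (S) in
/-- The type of all worlds. -/
def World : Type (max u v w) := {t : Formula S → Prop // IsWorld t}

namespace World

/-- Truth of a formula at a world. -/
def Holds (a : World S) (φ : Formula S) : Prop := a.1 φ

theorem isBoolean (a : World S) : Formula.IsBoolean a.Holds := a.2.toIsBoolean

theorem holds_of_provable (a : World S) {φ : Formula S} (h : Provable φ) : a.Holds φ :=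
  a.2.provable φ h

theorem holds_neg (a : World S) (φ : Formula S) : a.Holds (.neg φ) ↔ ¬ a.Holds φ :=
  a.isBoolean.neg φ

theorem holds_imp (a : World S) (φ ψ : Formula S) :
    a.Holds (.imp φ ψ) ↔ (a.Holds φ → a.Holds ψ) :=
  a.isBoolean.imp φ ψ

theorem holds_of_imp (a : World S) {φ ψ : Formula S} (h : Provable (.imp φ ψ))
    (hφ : a.Holds φ) : a.Holds ψ :=
  (a.holds_imp φ ψ).1 (a.holds_of_provable h) hφ

theorem holds_congr (a : World S) {φ ψ : Formula S} (h : Provable (.iff φ ψ)) :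
    a.Holds φ ↔ a.Holds ψ :=
  (a.isBoolean.iff φ ψ).1 (a.holds_of_provable h)

/-! ### Interventions and announcements acting on worlds -/

/-- The world resulting from an intervention. -/
def intervene (a : World S) (x : Assignment S) : World S :=
  ⟨fun φ => a.Holds (.intervene x φ),
    { neg := fun φ => (a.holds_congr (.a_neg x φ)).trans (a.holds_neg _)
      and := fun φ ψ => (a.holds_congr (.a_and x φ ψ)).trans (a.isBoolean.and _ _)
      provable := fun φ h => a.holds_of_provable (.nec_int x φ h) }⟩

/-- The world resulting from a truthful announcement. -/
def announce (a : World S) (α : Formula S) (hα : a.Holds α) : World S :=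
  ⟨fun φ => a.Holds (.announce α φ),
    { neg := fun φ => by
        rw [a.holds_congr (.ann_neg α φ), a.holds_imp, a.holds_neg]
        exact ⟨fun h => h hα, fun h _ => h⟩
      and := fun φ ψ => (a.holds_congr (.ann_and α φ ψ)).trans (a.isBoolean.and _ _)
      provable := fun φ h => a.holds_of_provable (.nec_ann α φ h) }⟩

theorem holds_intervene (a : World S) (x : Assignment S) (φ : Formula S) :
    (a.intervene x).Holds φ ↔ a.Holds (.intervene x φ) := Iff.rfl

theorem holds_announce (a : World S) (α : Formula S) (hα : a.Holds α) (φ : Formula S) :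
    (a.announce α hα).Holds φ ↔ a.Holds (.announce α φ) := Iff.rfl

theorem holds_announce_of_not (a : World S) {α : Formula S} (hα : ¬ a.Holds α) (φ : Formula S) :
    a.Holds (.announce α φ) := by
  -- The axiom for announced negations is vacuous when `α` fails, but it applies only to negations;
  -- hence the detour through the double negation.
  have h : a.Holds (.announce α (.neg (.neg φ))) := by
    rw [a.holds_congr (.ann_neg _ _), a.holds_imp]
    exact fun h => (hα h).elim
  have h' : Provable (.announce α (.imp (.neg (.neg φ)) φ)) := by
    refine .nec_ann _ _ (.taut _ fun t hn ha => ?_)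
    simp only [Formula.IsBoolean.imp ⟨hn, ha⟩, hn]
    tauto
  exact (a.holds_imp _ _).1 (a.holds_of_imp (.ann_k _ _ _) (a.holds_of_provable h')) h

/-! ### Knowledge -/

/-- The epistemic accessibility relation between worlds. -/
def Acc (a b : World S) : Prop := ∀ φ, a.Holds (.know φ) → b.Holds φ

theorem holds_know_of_derivable {a : World S} {Γ : Set (Formula S)}
    (hΓ : ∀ γ ∈ Γ, a.Holds (.know γ)) {φ : Formula S} (h : Derivable Γ φ) :
    a.Holds (.know φ) := by
  obtain ⟨l, hl, h⟩ := h
  induction l generalizing φ with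
  | nil =>
    refine a.holds_of_provable (.nec_know _ (.mp _ _ (.taut _ fun t hn ha => ?_) h))
    exact Formula.IsBoolean.top ⟨hn, ha⟩
  | cons ψ l ih =>
    rw [List.forall_mem_cons] at hl
    have h' := ih (φ := .imp ψ φ) hl.2 (.mp _ _ h (.taut _ fun t hn ha => by
      simp only [Formula.IsBoolean.imp ⟨hn, ha⟩, Formula.IsBoolean.bigAnd ⟨hn, ha⟩,
        List.forall_mem_cons]
      tauto))
    exact (a.holds_imp _ _).1 (a.holds_of_imp (.k _ _) h') (hΓ _ hl.1)

theorem holds_know (a : World S) (φ : Formula S) :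
    a.Holds (.know φ) ↔ ∀ b, a.Acc b → b.Holds φ := by
  refine ⟨fun h b hb => hb φ h, fun h => ?_⟩
  -- If `φ` did not follow from the known formulas, Lindenbaum's lemma would give an accessible
  -- world refuting it.
  refine holds_know_of_derivable (Γ := {ψ | a.Holds (.know ψ)}) (fun _ hγ => hγ) ?_
  by_contra hcon
  obtain ⟨t, ht, hΓ, hφ⟩ := exists_isWorld_of_not_derivable hcon
  exact hφ (h ⟨t, ht⟩ hΓ)

theorem acc_refl (a : World S) : a.Acc a := fun φ h => a.holds_of_imp (.t φ) h

theorem Acc.holds_know_iff {a b : World S} (h : a.Acc b) (φ : Formula S) :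
    a.Holds (.know φ) ↔ b.Holds (.know φ) := by
  refine ⟨fun h' => h _ (a.holds_of_imp (.four φ) h'), fun h' => ?_⟩
  by_contra hcon
  exact (b.holds_neg _).1 (h _ (a.holds_of_imp (.five φ) ((a.holds_neg _).2 hcon))) h'

theorem Acc.acc_iff {a b : World S} (h : a.Acc b) (c : World S) : a.Acc c ↔ b.Acc c :=
  forall_congr' fun φ => by rw [h.holds_know_iff φ]

/-! ### The causal model of a world -/

theorem exists_holds_intervene_eq (a : World S) (x : Assignment S) (Y : S.Var) :
    ∃ y : S.R Y, a.Holds (.intervene x (.eq Y y)) :=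
  (a.isBoolean.disj _).1 (a.holds_of_provable (.a2 x Y))

/-- The valuation of a world. -/
noncomputable def val (a : World S) : Valuation S := fun Y =>
  (a.exists_holds_intervene_eq .empty Y).choose

theorem holds_eq (a : World S) (Y : S.Var) (y : S.R Y) : a.Holds (.eq Y y) ↔ a.val Y = y := by
  have h := (a.exists_holds_intervene_eq .empty Y).choose_spec
  rw [a.holds_congr (.a_empty Y y)]
  constructor
  · intro h'
    by_contra hne
    exact (a.holds_neg _).1 (a.holds_of_imp (.a1 .empty Y _ _ hne) h) h'
  · rintro rfl
    exact h

theorem holds_intervene_eq (a : World S) (x : Assignment S) (Y : S.Var) (y : S.R Y) :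
    a.Holds (.intervene x (.eq Y y)) ↔ (a.intervene x).val Y = y :=
  (a.intervene x).holds_eq Y y

/-- One direction suffices because each variable has exactly one value at a world. -/
theorem val_ext {a b : World S} (h : ∀ Y y, a.Holds (.eq Y y) → b.Holds (.eq Y y)) :
    b.val = a.val :=
  funext fun Y => (b.holds_eq Y _).1 (h Y _ ((a.holds_eq Y _).2 rfl))

theorem val_intervene_empty (a : World S) : (a.intervene .empty).val = a.val :=
  val_ext fun Y y => (a.holds_congr (.a_empty Y y)).1

theorem val_intervene_intervene (a : World S) (x y : Assignment S) :
    ((a.intervene x).intervene y).val = (a.intervene (x.override y)).val :=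
  val_ext fun Y z => (a.holds_congr (.a_comp x y (.eq Y z) trivial)).2

theorem val_intervene_of_some (a : World S) {x : Assignment S} {Y : S.Var} {y : S.R Y}
    (h : x Y = some y) : (a.intervene x).val Y = y := by
  obtain ⟨z, hz, rfl⟩ := Assignment.exists_eq_insert h
  exact (a.holds_intervene_eq _ _ _).1 (a.holds_of_provable (.a4 z Y y hz))

theorem val_intervene_inl_of_none (a : World S) {x : Assignment S} {U : S.U}
    (h : x (.inl U) = none) : (a.intervene x).val (.inl U) = a.val (.inl U) := by
  rw [← a.val_intervene_empty, ← holds_intervene_eq, ← a.holds_congr (.a7 x U _ h),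
    holds_intervene_eq]

theorem val_intervene_insert (a : World S) {x : Assignment S} {Y : S.Var} (h : x Y = none) :
    (a.intervene (x.insert Y ((a.intervene x).val Y))).val = (a.intervene x).val := by
  refine val_ext fun Z z hz => a.holds_of_imp (.a3 x Y Z _ z h) ((a.isBoolean.and _ _).2 ⟨?_, hz⟩)
  exact (a.holds_intervene_eq _ _ _).2 rfl

open Classical in
/-- Intervening with further values that hold after an intervention anyway changes nothing. -/
theorem val_intervene_extend (a : World S) (x : Assignment S) (s : Finset S.Var) :
    (a.intervene fun Z => if x Z = none ∧ Z ∈ s then some ((a.intervene x).val Z) else x Z).val =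
      (a.intervene x).val := by
  induction s using Finset.induction_on with
  | empty => simp
  | insert Y s hY ih =>
    by_cases hx : x Y = none
    · have h := a.val_intervene_insert (Y := Y)
        (x := fun Z => if x Z = none ∧ Z ∈ s then some ((a.intervene x).val Z) else x Z)
        (by simp [hY, hx])
      rw [ih] at h
      refine Eq.trans ?_ h
      congr 2
      funext Z
      by_cases hZ : Z = Y
      · subst hZ
        rw [Assignment.insert_self, if_pos ⟨hx, Finset.mem_insert_self _ _⟩]
      · rw [Assignment.insert_of_ne _ _ hZ]
        simp [Finset.mem_insert, hZ]
    · refine Eq.trans ?_ ih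
      congr 2
      funext Z
      by_cases hZ : Z = Y
      · subst hZ
        simp [hx]
      · simp [Finset.mem_insert, hZ]

/-- Extend `x` by the resulting values of all variables except `X`. This links an arbitrary
intervention to the total ones that define `funs`. -/
theorem val_intervene_others (a : World S) {x : Assignment S} {X : S.Var} (h : x X = none) :
    (a.intervene ((a.intervene x).val.others X).toAssignment).val = (a.intervene x).val := by
  classical
  rw [← a.val_intervene_extend x (Finset.univ.erase X)]
  congr 2
  funext Z
  by_cases hZ : Z = X
  · subst hZ
    simp [Others.toAssignment_self, h]
  · rw [Others.toAssignment_of_ne _ hZ]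
    rw [a.val_intervene_extend]
    cases hx : x Z with
    | none => simp [hZ, Valuation.others]
    | some z => simp [Valuation.others, a.val_intervene_of_some hx]

/-- The structural functions of a world. -/
noncomputable def funs (a : World S) : StructFuns S := fun V b =>
  (a.intervene b.toAssignment).val (.inr V)

/-- By $A_{[][]}$ for atoms, the tuple of arguments overrides `x` everywhere except possibly at `V`
itself; if `x` assigns `V`, then $A_4$ makes the function constant. -/
theorem funs_intervene (a : World S) (x : Assignment S) :
    (a.intervene x).funs = a.funs.intervene x := by
  funext V b
  rw [funs, val_intervene_intervene, StructFuns.intervene]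
  cases hx : x (.inr V) with
  | none => rw [Assignment.override_toAssignment_of_none b hx, Option.getD_none, funs]
  | some v =>
    rw [Assignment.override_toAssignment_of_some b hx, Option.getD_some]
    exact a.val_intervene_of_some (Assignment.insert_self _ _ _)

theorem isPost_val_intervene (a : World S) (x : Assignment S) :
    IsPost a.funs x a.val (a.intervene x).val := by
  refine ⟨fun U => ?_, fun V => ?_⟩
  · cases hx : x (.inl U) with
    | none => rw [Option.getD_none, a.val_intervene_inl_of_none hx]
    | some u => rw [Option.getD_some, a.val_intervene_of_some hx]
  · rw [StructFuns.intervene]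
    cases hx : x (.inr V) with
    | none => rw [Option.getD_none, funs, a.val_intervene_others hx]
    | some v => rw [Option.getD_some, a.val_intervene_of_some hx]

theorem complies_val (a : World S) : a.funs.Complies a.val := by
  have h := (a.isPost_val_intervene .empty).2
  rwa [val_intervene_empty] at h

theorem holds_affects (a : World S) {X Y : S.Var} (h : a.funs.DirectlyAffects X Y) :
    a.Holds (.affects X Y) := by
  obtain ⟨-, V, rfl, b, c, hbc, hne⟩ := h
  refine (a.isBoolean.affects _ _).2 ⟨b, c, a.funs V b, a.funs V c, ?_, hbc, hne,
    (a.holds_intervene_eq _ _ _).2 rfl, (a.holds_intervene_eq _ _ _).2 rfl⟩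
  rintro rfl
  exact hne rfl

end World

/-- The path is put into the indexed form of $A_6$. The final arrow into `b` is kept apart, to serve
as the arrow that closes a cycle when `b = a`. -/
theorem exists_chain_of_transGen {α : Type*} {r : α → α → Prop} {a b : α}
    (h : Relation.TransGen r a b) : ∃ (k : ℕ) (f : Fin (k + 1) → α), f 0 = a ∧
      (∀ i : Fin k, r (f i.castSucc) (f i.succ)) ∧ r (f (Fin.last k)) b := by
  induction h with
  | single h => exact ⟨0, fun _ => a, rfl, fun i => i.elim0, h⟩
  | @tail b c _ hbc ih =>
    obtain ⟨k, f, h0, hf, hl⟩ := ih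
    refine ⟨k + 1, Fin.snoc f b, ?_, fun i => ?_, ?_⟩
    · rw [← Fin.castSucc_zero, Fin.snoc_castSucc (α := fun _ => α), h0]
    · induction i using Fin.lastCases with
      | last =>
        rw [Fin.succ_last, Fin.snoc_last (α := fun _ => α), Fin.snoc_castSucc (α := fun _ => α)]
        exact hl
      | cast i =>
        rw [Fin.succ_castSucc, Fin.snoc_castSucc (α := fun _ => α),
          Fin.snoc_castSucc (α := fun _ => α)]
        exact hf i
    · rwa [Fin.snoc_last (α := fun _ => α)]

namespace World

theorem recursive_funs (a : World S) : a.funs.Recursive := by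
  intro X Y hXY hYX
  obtain ⟨k, f, rfl, hf, hl⟩ := exists_chain_of_transGen (hXY.trans hYX)
  refine (a.holds_neg _).1 (a.holds_of_imp (.a6 k f) ((a.isBoolean.bigAnd _).2 ?_))
    (a.holds_affects hl)
  intro φ hφ
  obtain ⟨i, rfl⟩ := List.mem_ofFn.1 hφ
  exact a.holds_affects (hf i)

theorem val_intervene (a : World S) (x : Assignment S) :
    (a.intervene x).val = post a.funs x a.val :=
  (a.isPost_val_intervene x).eq_post a.recursive_funs

/-- $KL$ says that the values of structural functions are known. -/
theorem Acc.funs_eq {a b : World S} (h : a.Acc b) : b.funs = a.funs := by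
  funext V c
  refine (b.holds_intervene_eq _ _ _).1 (h _ (a.holds_of_imp (.kl V c _) ?_))
  exact (a.holds_intervene_eq _ _ _).2 rfl

/-! ### Epistemic states of worlds -/

/-- The epistemic state of a world: the valuations of the accessible worlds. -/
def team (a : World S) : Set (Valuation S) := {B | ∃ b, a.Acc b ∧ b.val = B}

theorem val_mem_team (a : World S) : a.val ∈ a.team := ⟨a, a.acc_refl, rfl⟩

theorem Acc.team_eq {a b : World S} (h : a.Acc b) : b.team = a.team := by
  ext B
  exact exists_congr fun c => and_congr_left fun _ => (h.acc_iff c).symm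

theorem holds_valEq (a : World S) (A : Valuation S) : a.Holds (.valEq A) ↔ a.val = A := by
  rw [Formula.valEq, a.isBoolean.bigAnd]
  simp only [List.forall_mem_map, Finset.mem_toList, Finset.mem_univ, true_imp_iff, holds_eq]
  exact funext_iff.symm

/-- Since there are finitely many variables, a valuation is described by one formula. Teams of
transformed worlds can thus be found without describing the worlds accessible from them. -/
theorem mem_team_iff (a : World S) (B : Valuation S) :
    B ∈ a.team ↔ ¬ a.Holds (.know (.neg (.valEq B))) := by
  rw [holds_know]
  push Not
  simp only [holds_neg, not_not, holds_valEq]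
  rfl

theorem funs_announce (a : World S) (α : Formula S) (hα : a.Holds α) :
    (a.announce α hα).funs = a.funs := by
  funext V b
  refine (holds_intervene_eq _ _ _ _).1 ?_
  rw [holds_announce, a.holds_congr (.ann_eq _ _ _ _), holds_imp]
  exact fun _ => (a.holds_intervene_eq _ _ _).2 rfl

theorem val_intervene_announce (a : World S) (α : Formula S) (hα : a.Holds α)
    (x : Assignment S) : ((a.announce α hα).intervene x).val = (a.intervene x).val := by
  refine val_ext fun Y y h => ?_
  rw [holds_intervene, holds_announce, a.holds_congr (.ann_eq _ _ _ _), holds_imp]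
  exact fun _ => h

theorem val_announce (a : World S) (α : Formula S) (hα : a.Holds α) :
    (a.announce α hα).val = a.val := by
  rw [← val_intervene_empty, val_intervene_announce, val_intervene_empty]

theorem holds_announce_know (a : World S) {α : Formula S} (hα : a.Holds α) (φ : Formula S) :
    a.Holds (.announce α (.know φ)) ↔
      ∀ b, a.Acc b → ∀ h : b.Holds α, (b.announce α h).Holds φ := by
  rw [a.holds_congr (.ann_know _ _), holds_imp, holds_know]
  simp only [holds_imp, hα, true_imp_iff, holds_announce]

theorem mem_team_announce_iff (a : World S) (α : Formula S) (hα : a.Holds α) (B : Valuation S) :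
    B ∈ (a.announce α hα).team ↔ ∃ b, a.Acc b ∧ b.Holds α ∧ b.val = B := by
  rw [mem_team_iff, holds_announce, a.holds_announce_know hα]
  push Not
  simp only [holds_neg, not_not, holds_valEq, val_announce]
  simp

theorem holds_intervene_obsEq (a : World S) (x : Assignment S) (o : Formula.ObsValues S) :
    a.Holds (.intervene x (.obsEq o)) ↔ ∀ X, (a.intervene x).val X.1 = o X := by
  rw [← holds_intervene, (a.intervene x).isBoolean.obsEq]
  simp only [holds_eq]

theorem team_intervene (a : World S) (x : Assignment S) :
    (a.intervene x).team = postTeam a.funs x a.team a.val := by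
  ext B
  have key : ∀ o : Formula.ObsValues S, (∀ X, (a.intervene x).val X.1 = o X) →
      (a.Holds (.announce (.intervene x (.obsEq o)) (.know (.intervene x (.neg (.valEq B))))) ↔
        ∀ b, a.Acc b → (∀ X, (b.intervene x).val X.1 = o X) → (b.intervene x).val ≠ B) := by
    intro o ho
    rw [a.holds_announce_know ((a.holds_intervene_obsEq x o).2 ho)]
    refine forall₂_congr fun b _ => ?_
    simp only [← holds_intervene _ x, holds_neg, holds_valEq, val_intervene_announce]
    rw [← holds_intervene_obsEq]
    rfl
  -- $PD$, applied to "the valuation is not `B`", reduces knowledge after the intervention to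
  -- knowledge at `a` after an announcement; `key` evaluates the latter.
  rw [mem_team_iff, holds_intervene, a.holds_congr (.pd x _), a.isBoolean.disj]
  simp only [a.isBoolean.and, holds_intervene_obsEq]
  constructor
  · intro h
    have h' := not_exists.1 h fun X => (a.intervene x).val X.1
    rw [not_and, key _ fun _ => rfl] at h'
    have h' := h' fun _ => rfl
    push Not at h'
    obtain ⟨b, hb, hobs, rfl⟩ := h'
    rw [val_intervene, hb.funs_eq] at hobs ⊢
    exact ⟨⟨b.val, ⟨b, hb, rfl⟩, rfl⟩, fun X hX => by rw [hobs ⟨X, hX⟩, val_intervene]⟩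
  · rintro ⟨⟨_, ⟨b, hb, rfl⟩, rfl⟩, hobs⟩ ⟨o, ho, h⟩
    rw [key o ho] at h
    have hval : (b.intervene x).val = post a.funs x b.val := by rw [val_intervene, hb.funs_eq]
    refine h b hb (fun X => ?_) hval
    rw [hval, hobs X.1 X.2, ← val_intervene, ho X]

/-- The epistemic causal model of a world. -/
noncomputable def model (a : World S) : EpistemicModel S where
  F := a.funs
  T := a.team
  recursive := a.recursive_funs
  nonempty := ⟨_, a.val_mem_team⟩
  complies := by
    rintro _ ⟨b, hb, rfl⟩
    rw [← hb.funs_eq]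
    exact b.complies_val
  obs_const := by
    -- $OC$ without intervention: some tuple of observable values is known, so all accessible worlds
    -- share it.
    obtain ⟨o, ho⟩ := (a.isBoolean.disj _).1 (a.holds_of_provable .oc_nil)
    have h : ∀ B ∈ a.team, ∀ X : {X : S.Var // X ∈ S.O}, B X.1 = o X := by
      rintro _ ⟨b, hb, rfl⟩ X
      exact (b.holds_eq _ _).1 ((b.isBoolean.obsEq o).1 (hb _ ho) X)
    exact fun A hA B hB X hX => (h A hA ⟨X, hX⟩).trans (h B hB ⟨X, hX⟩).symm

/-- The truth lemma. -/
theorem holds_iff_sat (φ : Formula S) :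
    ∀ a : World S, a.Holds φ ↔ Sat φ a.funs a.team a.val := by
  induction φ with
  | eq Y y => exact fun a => a.holds_eq Y y
  | neg φ ih => exact fun a => (a.holds_neg φ).trans (not_congr (ih a))
  | and φ ψ ih1 ih2 => exact fun a => (a.isBoolean.and φ ψ).trans (and_congr (ih1 a) (ih2 a))
  | know φ ih =>
    intro a
    rw [holds_know]
    -- Accessible worlds share functions and team, so by the induction hypothesis truth of `φ`
    -- depends only on the valuation; distinct worlds with equal valuations do no harm.
    have h : ∀ b, a.Acc b → (b.Holds φ ↔ Sat φ a.funs a.team b.val) := fun b hb => by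
      rw [ih b, hb.funs_eq, hb.team_eq]
    constructor
    · rintro h' _ ⟨b, hb, rfl⟩
      exact (h b hb).1 (h' b hb)
    · exact fun h' b hb => (h b hb).2 (h' _ ⟨b, hb, rfl⟩)
  | announce α φ ih1 ih2 =>
    intro a
    by_cases hα : a.Holds α
    · have hT : (a.announce α hα).team = {B | B ∈ a.team ∧ Sat α a.funs a.team B} := by
        ext B
        rw [mem_team_announce_iff]
        constructor
        · rintro ⟨b, hb, hbα, rfl⟩
          rw [ih1 b, hb.funs_eq, hb.team_eq] at hbα
          exact ⟨⟨b, hb, rfl⟩, hbα⟩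
        · rintro ⟨⟨b, hb, rfl⟩, hbα⟩
          refine ⟨b, hb, ?_, rfl⟩
          rwa [ih1 b, hb.funs_eq, hb.team_eq]
      -- The induction hypothesis for `φ` is used at the announced world, whose team is the semantic
      -- restriction by the hypothesis for `α`.
      rw [← a.holds_announce α hα, ih2, funs_announce, val_announce, hT]
      exact ⟨fun h _ => h, fun h => h ((ih1 a).1 hα)⟩
    · exact iff_of_true (a.holds_announce_of_not hα φ) fun h => (hα ((ih1 a).2 h)).elim
  | intervene x φ ih =>
    intro a
    rw [← holds_intervene, ih, funs_intervene, val_intervene, team_intervene]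
    rfl

end World

/-! ### Soundness and completeness with premises -/

theorem Derivable.entails {Γ : Set (Formula S)} {φ : Formula S} (h : Derivable Γ φ) :
    Entails Γ φ := by
  obtain ⟨l, hl, h⟩ := h
  intro M A hA hΓ
  have hs := isBoolean_sat M.F M.T A
  exact (hs.imp _ _).1 (h.sound M A hA) ((hs.bigAnd l).2 fun ψ hψ => hΓ ψ (hl ψ hψ))

theorem Entails.derivable {Γ : Set (Formula S)} {φ : Formula S} (h : Entails Γ φ) :
    Derivable Γ φ := by
  by_contra hcon
  obtain ⟨t, ht, hΓ, hφ⟩ := exists_isWorld_of_not_derivable hcon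
  let a : World S := ⟨t, ht⟩
  exact hφ ((a.holds_iff_sat φ).2 (h a.model a.val a.val_mem_team fun γ hγ =>
    (a.holds_iff_sat γ).1 (hΓ γ hγ)))

end Worlds

end ObsCausal

/-- Soundness and strong completeness of the axiom system with observables. -/
theorem theorem4 (S : ObsCausal.Signature.{u, v, w}) [Nonempty S.Var]
    (Γ : Set (ObsCausal.Formula S)) (φ : ObsCausal.Formula S) :
    ObsCausal.Entails Γ φ ↔ ObsCausal.Derivable Γ φ :=
  ⟨ObsCausal.Entails.derivable, ObsCausal.Derivable.entails⟩
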